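/- **Model.** There are $n$ nodes $1,\dots,n$, the first $n_L<n$ of which form the hub set, and $T$ observed groups $G^{(1)},\dots,G^{(T)}\in\{0,1\}^n$ ($G^{(t)}_j=1$ means that node $j$ belongs to group $t$). In the hub model with the null component with parameters $\rho=(\rho_0,\dots,\rho_{n_L})$ (a probability vector) and $A=(A_{ij})_{0\le i\le n_L,\,1\le j\le n}$, $A_{ij}\in[0,1]$, $A_{ii}=1$ for $i=1,\dots,n_L$, the groups are generated independently: a latent hub label $z_*^{(t)}\in\{0,1,\dots,n_L\}$ (label $0$ means hubless) is drawn with $\mathbb P(z_*^{(t)}=i)=\rho_i$, and given $z_*^{(t)}=i$ the nodes appear in the group independently with $\mathbb P(G^{(t)}_j=1\mid z_*^{(t)}=i)=A_{ij}$. **Estimator.** For labels $z=(z^{(t)})_{t\le T}\in\{0,\dots,n_L\}^T$ let $t_i=\#\{t:z^{(t)}=i\}$, $\hat A^z_{ij}=\sum_t G_j^{(t)}1(z^{(t)}=i)/t_i$ (and $\hat A^z_{ij}=0$ if $t_i=0$), and $$L_G(z)=\sum_{t}\sum_{j} G_j^{(t)}\log \hat A^z_{z^{(t)},j}+(1-G_j^{(t)})\log\bigl(1-\hat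 A^z_{z^{(t)},j}\bigr),\qquad 0\log 0=0 .$$ Let $\hat z$ be any maximizer of $L_G$ over the feasible labels, i.e. those for which $z^{(t)}=i\ge1$ implies $G^{(t)}_i=1$ (as forced by $A_{ii}=1$). Let $T_e=\#\{t:\hat z^{(t)}\ne z_*^{(t)}\}$. **Theorem.** Consider a sequence of such models with $n_L\to\infty$, $n\to\infty$, $T\to\infty$, in which $\rho$, $A$, $d>0$ and $v>0$ may vary along the sequence, and let $c_{\min},s_{\min},s_{\max},\tau,c_0>0$ and $c_{\max}$ be constants that do not. Assume: - $H_1^*$: with probability tending to $1$, $Tc_{\min}/n_L\le t_{i*}\le Tc_{\max}/n_L$ for all $i=0,\dots,n_L$, where $t_{i*}=\#\{t:z_*^{(t)}=i\}$; - $H_2^*$: $A_{ij}=s_{ij}d$ with $s_{\min}\le s_{ij}\le s_{\max}$ for all $i=0,\dots,n_L$, $j=1,\dots,n$, $i\ne j$, and $d\to0$; - $H_3^*$: for each $i=1,\dots,n_L$ there is a set $V_i\subset\{n_L+1,\dots,n\}$ with $|V_i|\ge vn/n_L$ and $s_{ij}-s_{i'j}\ge\tau$ for all $j\in V_i$ and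 all $i'\in\{0,\dots,n_L\}$, $i'\neq i$; - $H_4^*$: $A_{ii'}\le c_0/n_L$ for $i=0,\dots,n_L$, $i'=1,\dots,n_L$, $i\ne i'$; - rates: $\dfrac{n_L^4\log T}{dTv}\to0$, $\dfrac{(\log d)^2n_L^6\log n_L}{dnv^2}\to0$ and $\dfrac{(\log T)^2n_L^6\log n_L}{dnv^2}\to0$. Then $T_e/T=o_p(1)$, that is, $\mathbb P(T_e/T\ge\varepsilon)\to0$ for every $\varepsilon>0$. -/

import Mathlib

open Filter Topology MeasureTheory

/-!
The hub model with the null component. There are `n` nodes `Fin n`, of which the first `L` form the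
hub set, and `T` groups. Hub labels live in `Fin (L + 1)`: the label `0` means hubless, and the
label `i ≥ 1` stands for the `i`-th node, that is, for the element of `Fin n` with value `i - 1`.
-/

namespace HubModel

/-- The label `i` (with `i ≥ 1`) is the label of the node `j`. -/
def IsNode {L n : ℕ} (i : Fin (L + 1)) (j : Fin n) : Prop := (i : ℕ) = (j : ℕ) + 1

/-- The parameter space: `ρ` is a probability vector on the labels, the entries of `A` are
probabilities, and a hub belongs to every group that it forms. -/
structure IsParam {L n : ℕ} (ρ : Fin (L + 1) → ℝ) (A : Fin (L + 1) → Fin n → ℝ) : Prop where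
  rho_nonneg : ∀ i, 0 ≤ ρ i
  rho_sum : ∑ i, ρ i = 1
  nonneg : ∀ i j, 0 ≤ A i j
  le_one : ∀ i j, A i j ≤ 1
  self : ∀ i j, IsNode i j → A i j = 1

/-- The joint probability of the hub labels `z` and the groups `g`: independently for each group,
the label is drawn from `ρ`, and then each node `j` appears independently with probability
`A (z t) j`. -/
noncomputable def jointProb {L n T : ℕ} (ρ : Fin (L + 1) → ℝ) (A : Fin (L + 1) → Fin n → ℝ)
    (z : Fin T → Fin (L + 1)) (g : Fin T → Fin n → Bool) : ℝ :=
  ∏ t, (ρ (z t) * ∏ j, if g t j then A (z t) j else 1 - A (z t) j)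

/-- The random labels `zs` and the random groups `G` follow the hub model with the null component
with parameters `ρ`, `A`. -/
structure IsHubModel {Ω : Type*} [MeasurableSpace Ω] (μ : Measure Ω) {L n T : ℕ}
    (ρ : Fin (L + 1) → ℝ) (A : Fin (L + 1) → Fin n → ℝ)
    (zs : Ω → Fin T → Fin (L + 1)) (G : Ω → Fin T → Fin n → Bool) : Prop where
  param : IsParam ρ A
  measurable_label : Measurable zs
  measurable_group : Measurable G
  law : ∀ z g, μ {ω | zs ω = z ∧ G ω = g} = ENNReal.ofReal (jointProb ρ A z g)

/-- `t_i`, the number of groups with label `i`. -/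
def count {L T : ℕ} (z : Fin T → Fin (L + 1)) (i : Fin (L + 1)) : ℕ :=
  (Finset.univ.filter fun t => z t = i).card

/-- The observation `G_j^{(t)}` as a real number, `0` or `1`. -/
def obs {n T : ℕ} (g : Fin T → Fin n → Bool) (t : Fin T) (j : Fin n) : ℝ :=
  if g t j then 1 else 0

/-- The maximum likelihood estimator `Â^z` of `A` given the labels `z`
(equal to `0` when no group has label `i`). -/
noncomputable def estA {L n T : ℕ} (g : Fin T → Fin n → Bool) (z : Fin T → Fin (L + 1))
    (i : Fin (L + 1)) (j : Fin n) : ℝ :=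
  (∑ t, if z t = i then obs g t j else 0) / (count z i : ℝ)

/-- The profile log-likelihood `L_G(z)`. (The convention `0 * log 0 = 0` is that of the reals here:
an estimate that is `0` or `1` agrees with all the observations it is fitted to.) -/
noncomputable def profileLogLik {L n T : ℕ} (g : Fin T → Fin n → Bool)
    (z : Fin T → Fin (L + 1)) : ℝ :=
  ∑ t, ∑ j, (obs g t j * Real.log (estA g z (z t) j) +
    (1 - obs g t j) * Real.log (1 - estA g z (z t) j))

/-- The labels `z` are feasible: a node that is the labelled hub of a group appears in it.
As `A_ii = 1`, these are exactly the labels with a nonzero likelihood for some parameter. -/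
def Feasible {L n T : ℕ} (g : Fin T → Fin n → Bool) (z : Fin T → Fin (L + 1)) : Prop :=
  ∀ t j, IsNode (z t) j → g t j = true

/-- `z` is a maximum profile likelihood estimate of the hub labels. -/
def IsProfileMLE {L n T : ℕ} (g : Fin T → Fin n → Bool) (z : Fin T → Fin (L + 1)) : Prop :=
  Feasible g z ∧ ∀ z' : Fin T → Fin (L + 1), Feasible g z' → profileLogLik g z' ≤ profileLogLik g z

/-- `T_e`, the number of groups whose labels under `z` and `z'` differ. -/
def numErrors {L T : ℕ} (z z' : Fin T → Fin (L + 1)) : ℕ :=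
  (Finset.univ.filter fun t => z t ≠ z' t).card

end HubModel

/-! Condition on the true labels, so that all entries of the groups are independent Bernoulli
variables. The estimated labels fit at least as well as the true ones. Away from the hub columns
this compares two genuine likelihoods; each of the at most `L` hub columns is handled crudely, since
its profile log-likelihood lies in `[-T log 2, 0]`. Hence a product law `q` with means `Â` outside
the hub columns comes within a factor `exp (T L log 2)` of the true law
(`groupProb_le_of_isProfileMLE`). For a fixed `q` this has probability at most `exp (T L log 2 / 2 -
D / 2)`, where `D` is the sum of the squared differences of the square roots of the means
(`sum_groupProb_likelihood_le`). There are at most `(L+1)^T (T+1)^(n(L+1))` candidates `q`: a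
labelling together with counts of appearances. A union bound therefore suffices once `D` exceeds
this entropy.

The sets `V_k` make `D` large when the estimated classes mix true labels: no value constant on a
class can be near two separated means (`sum_sq_sub_ge`). Small `D` thus leaves nearly pure classes,
but does not say which true label a class carries. Feasibility decides that: every group labelled `i
≥ 1` contains node `i`, while by Chernoff only `O(T / L²)` groups of any other true label do. A
class `0` dominated by a true hub label has size `O(T / L)`. So the number of errors is at most
twice the total impurity plus `O(T / L)` (`numErrors_le`). With `εT` errors, `D` is of order `d v n
T / L`, which the rates make larger than the entropy terms `T L` and `n L log T`. -/

namespace HubModel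

/-! ### Product Bernoulli laws: affinity and Chernoff bounds. -/

/-- The probability that a Bernoulli variable with mean `p` takes the value `b`. -/
def bern (p : ℝ) (b : Bool) : ℝ := if b then p else 1 - p

lemma bern_nonneg {p : ℝ} (h0 : 0 ≤ p) (h1 : p ≤ 1) (b : Bool) : 0 ≤ bern p b := by
  cases b <;> simp [bern, h0, h1]

/-- The probability of the groups `g` when the entries are independent with means `p`. -/
def groupProb {n T : ℕ} (p : Fin T → Fin n → ℝ) (g : Fin T → Fin n → Bool) : ℝ :=
  ∏ t, ∏ j, bern (p t j) (g t j)

lemma groupProb_nonneg {n T : ℕ} {p : Fin T → Fin n → ℝ} (h0 : ∀ t j, 0 ≤ p t j)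
    (h1 : ∀ t j, p t j ≤ 1) (g : Fin T → Fin n → Bool) : 0 ≤ groupProb p g :=
  Finset.prod_nonneg fun t _ => Finset.prod_nonneg fun j _ => bern_nonneg (h0 t j) (h1 t j) _

lemma sum_prod_bool {n T : ℕ} (F : Fin T → Fin n → Bool → ℝ) :
    ∑ g : Fin T → Fin n → Bool, ∏ t, ∏ j, F t j (g t j) =
      ∏ t, ∏ j, (F t j true + F t j false) := by
  have h : ∀ t, ∏ j, (F t j true + F t j false) = ∑ r : Fin n → Bool, ∏ j, F t j (r j) := by
    intro t
    have := Finset.prod_univ_sum (fun _ : Fin n => (Finset.univ : Finset Bool)) (F t)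
    simpa only [Fintype.piFinset_univ, Fintype.sum_bool] using this
  simp_rw [h]
  have := Finset.prod_univ_sum (fun _ : Fin T => (Finset.univ : Finset (Fin n → Bool)))
    (fun t r => ∏ j, F t j (r j))
  simpa only [Fintype.piFinset_univ] using this.symm

/-- Markov's inequality for product functionals. -/
lemma sum_groupProb_le {n T : ℕ} {p : Fin T → Fin n → ℝ} (E : Finset (Fin T → Fin n → Bool))
    (F : Fin T → Fin n → Bool → ℝ) (hF : ∀ t j b, 0 ≤ F t j b) (c : ℝ) (hc : 0 ≤ c)
    (hE : ∀ g ∈ E, groupProb p g ≤ c * ∏ t, ∏ j, F t j (g t j)) :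
    ∑ g ∈ E, groupProb p g ≤ c * ∏ t, ∏ j, (F t j true + F t j false) := by
  calc ∑ g ∈ E, groupProb p g ≤ ∑ g ∈ E, c * ∏ t, ∏ j, F t j (g t j) := Finset.sum_le_sum hE
    _ ≤ ∑ g : Fin T → Fin n → Bool, c * ∏ t, ∏ j, F t j (g t j) := by
        refine Finset.sum_le_sum_of_subset_of_nonneg (Finset.subset_univ E) fun g _ _ => ?_
        exact mul_nonneg hc (Finset.prod_nonneg fun t _ => Finset.prod_nonneg fun j _ => hF _ _ _)
    _ = _ := by rw [← Finset.mul_sum, sum_prod_bool]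

/-- The first term equals `(a + b) / 2 - (√a - √b)² / 2` and the second is at most `1 - (a + b) / 2`
by AM-GM; then `1 + x ≤ exp x`. -/
lemma hellinger_affinity_le {a b : ℝ} (ha : 0 ≤ a) (ha' : a ≤ 1) (hb : 0 ≤ b) (hb' : b ≤ 1) :
    √(a * b) + √((1 - a) * (1 - b)) ≤ Real.exp (-(√a - √b) ^ 2 / 2) := by
  have h1 : √((1 - a) * (1 - b)) ≤ ((1 - a) + (1 - b)) / 2 := by
    rw [Real.sqrt_mul (by linarith)]
    nlinarith [sq_nonneg (√(1 - a) - √(1 - b)), Real.sq_sqrt (sub_nonneg.2 ha'),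
      Real.sq_sqrt (sub_nonneg.2 hb')]
  have h2 := Real.add_one_le_exp (-(√a - √b) ^ 2 / 2)
  rw [Real.sqrt_mul ha]
  nlinarith [Real.sq_sqrt ha, Real.sq_sqrt hb]

/-- The probability, under the means `p`, that the likelihood of `q` comes within a factor
`exp a` of the likelihood of `p`. -/
lemma sum_groupProb_likelihood_le {n T : ℕ} {p q : Fin T → Fin n → ℝ}
    (hp : ∀ t j, 0 ≤ p t j) (hp' : ∀ t j, p t j ≤ 1) (hq : ∀ t j, 0 ≤ q t j)
    (hq' : ∀ t j, q t j ≤ 1) (a : ℝ) (E : Finset (Fin T → Fin n → Bool))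
    (hE : ∀ g ∈ E, groupProb p g ≤ Real.exp a * groupProb q g) :
    ∑ g ∈ E, groupProb p g ≤
      Real.exp (a / 2 - (∑ t, ∑ j, (√(p t j) - √(q t j)) ^ 2) / 2) := by
  -- On `E`, `p = √(p * p) ≤ exp (a / 2) * √(p * q)`, and the sum of `√(p * q)` factorizes over the
  -- entries.
  have key := sum_groupProb_le (p := p) E (fun t j b => √(bern (p t j) b * bern (q t j) b))
    (fun _ _ _ => Real.sqrt_nonneg _) (Real.exp (a / 2)) (Real.exp_pos _).le ?_
  · refine key.trans ?_
    rw [sub_eq_add_neg, Real.exp_add]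
    refine mul_le_mul_of_nonneg_left ?_ (Real.exp_pos _).le
    rw [show -((∑ t, ∑ j, (√(p t j) - √(q t j)) ^ 2) / 2) =
      ∑ t, ∑ j, (-(√(p t j) - √(q t j)) ^ 2 / 2) by
        simp only [neg_div, Finset.sum_neg_distrib, Finset.sum_div], Real.exp_sum]
    refine Finset.prod_le_prod
      (fun t _ => Finset.prod_nonneg fun j _ => by positivity) fun t _ => ?_
    rw [Real.exp_sum]
    refine Finset.prod_le_prod (fun j _ => by positivity) fun j _ => ?_
    simpa [bern] using hellinger_affinity_le (hp t j) (hp' t j) (hq t j) (hq' t j)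
  · intro g hg
    have h1 : ∏ t, ∏ j, √(bern (p t j) (g t j) * bern (q t j) (g t j)) =
        √(groupProb p g * groupProb q g) := by
      unfold groupProb
      simp_rw [← Finset.prod_mul_distrib]
      rw [Real.sqrt_eq_rpow, ← Real.finsetProd_rpow]
      · refine Finset.prod_congr rfl fun t _ => ?_
        rw [← Real.finsetProd_rpow]
        · simp_rw [Real.sqrt_eq_rpow]
        · exact fun j _ => mul_nonneg (bern_nonneg (hp _ _) (hp' _ _) _)
            (bern_nonneg (hq _ _) (hq' _ _) _)
      · exact fun t _ => Finset.prod_nonneg fun j _ =>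
          mul_nonneg (bern_nonneg (hp _ _) (hp' _ _) _) (bern_nonneg (hq _ _) (hq' _ _) _)
    have hP := groupProb_nonneg hp hp' g
    show _ ≤ Real.exp (a / 2) * ∏ t, ∏ j, √(bern (p t j) (g t j) * bern (q t j) (g t j))
    rw [h1]
    have h2 : Real.exp (a / 2) = √(Real.exp a) := by rw [Real.exp_half]
    rw [h2, ← Real.sqrt_mul (Real.exp_pos _).le]
    refine Real.le_sqrt_of_sq_le ?_
    nlinarith [mul_le_mul_of_nonneg_left (hE g hg) hP]

/-- Chernoff bound: the number of `t ∈ I` for which the node `j` appears. -/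
lemma sum_groupProb_appear_le {n T : ℕ} {p : Fin T → Fin n → ℝ}
    (hp : ∀ t j, 0 ≤ p t j) (hp' : ∀ t j, p t j ≤ 1) (I : Finset (Fin T)) (j : Fin n) (c M : ℝ)
    (hc : ∀ t ∈ I, p t j ≤ c) :
    ∑ g with M ≤ ((I.filter fun t => g t j = true).card : ℝ), groupProb p g ≤
      Real.exp (2 * (I.card * c) - M) := by
  have key := sum_groupProb_le (p := p)
    (Finset.univ.filter fun g : Fin T → Fin n → Bool =>
      M ≤ ((I.filter fun t => g t j = true).card : ℝ))
    (fun t j' b => bern (p t j') b * (if t ∈ I ∧ j' = j ∧ b = true then Real.exp 1 else 1))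
    (fun t j' b => mul_nonneg (bern_nonneg (hp _ _) (hp' _ _) _) (by split_ifs <;> positivity))
    (Real.exp (-M)) (Real.exp_pos _).le ?_
  · refine key.trans ?_
    rw [sub_eq_add_neg, add_comm, Real.exp_add]
    refine mul_le_mul_of_nonneg_left ?_ (Real.exp_pos _).le
    have h1 : ∀ t, ∏ j', (bern (p t j') true *
          (if t ∈ I ∧ j' = j ∧ true = true then Real.exp 1 else 1) +
        bern (p t j') false * (if t ∈ I ∧ j' = j ∧ false = true then Real.exp 1 else 1)) ≤
        Real.exp (if t ∈ I then 2 * c else 0) := by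
      intro t
      rw [Finset.prod_eq_single j]
      · by_cases ht : t ∈ I
        -- The factor is `1 + p (e - 1) ≤ 1 + 2c ≤ exp (2c)`, because `e < 3`.
        · simp only [ht, bern]
          have h3 := Real.add_one_le_exp (2 * c)
          have h4 := Real.exp_one_lt_d9
          have := hc t ht
          have := hp t j
          simp
          nlinarith
        · simp [ht, bern]
      · intro b _ hb
        simp [hb, bern]
      · simp
    refine (Finset.prod_le_prod (fun t _ => Finset.prod_nonneg fun j' _ => add_nonneg
      (mul_nonneg (bern_nonneg (hp _ _) (hp' _ _) _) (by split_ifs <;> positivity))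
      (mul_nonneg (bern_nonneg (hp _ _) (hp' _ _) _) (by split_ifs <;> positivity)))
      fun t _ => h1 t).trans ?_
    rw [← Real.exp_sum]
    refine Real.exp_le_exp.2 (le_of_eq ?_)
    simp
    ring
  · intro g hg
    have hg' := (Finset.mem_filter.1 hg).2
    have h1 : ∏ t, ∏ j', (if t ∈ I ∧ j' = j ∧ g t j' = true then Real.exp 1 else 1) =
        Real.exp ((I.filter fun t => g t j = true).card : ℝ) := by
      have : ∀ t, ∏ j', (if t ∈ I ∧ j' = j ∧ g t j' = true then Real.exp 1 else 1) =
          if t ∈ I.filter (fun t => g t j = true) then Real.exp 1 else 1 := by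
        intro t
        rw [Finset.prod_eq_single j]
        · simp
        · intro b _ hb
          simp [hb]
        · simp
      simp_rw [this]
      rw [Finset.prod_ite_mem, Finset.univ_inter, Finset.prod_const, ← Real.exp_nat_mul, mul_one]
    simp_rw [Finset.prod_mul_distrib]
    rw [h1]
    have := groupProb_nonneg hp hp' g
    rw [mul_left_comm, ← Real.exp_add]
    exact le_mul_of_one_le_right this (Real.one_le_exp (by linarith))


/-! ### The profile likelihood, column by column. -/

section

variable {L n T : ℕ}

lemma count_pos (z : Fin T → Fin (L + 1)) (t : Fin T) : 0 < count z (z t) :=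
  Finset.card_pos.2 ⟨t, by simp⟩

/-- The number of groups with label `i` in which the node `j` appears. -/
def hits (g : Fin T → Fin n → Bool) (z : Fin T → Fin (L + 1)) (i : Fin (L + 1)) (j : Fin n) : ℕ :=
  (Finset.univ.filter fun t => z t = i ∧ g t j = true).card

lemma hits_le_count (g : Fin T → Fin n → Bool) (z : Fin T → Fin (L + 1)) (i : Fin (L + 1))
    (j : Fin n) : hits g z i j ≤ count z i :=
  Finset.card_le_card fun t ht => by simp_all

lemma hits_le (g : Fin T → Fin n → Bool) (z : Fin T → Fin (L + 1)) (i : Fin (L + 1))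
    (j : Fin n) : hits g z i j ≤ T :=
  (Finset.card_le_univ _).trans (by simp)

lemma estA_eq (g : Fin T → Fin n → Bool) (z : Fin T → Fin (L + 1)) (i : Fin (L + 1))
    (j : Fin n) : estA g z i j = (hits g z i j : ℝ) / count z i := by
  unfold estA hits
  congr 1
  rw [Finset.card_filter]
  push_cast
  refine Finset.sum_congr rfl fun t _ => ?_
  by_cases h1 : z t = i <;> cases h2 : g t j <;> simp [obs, h1, h2]

lemma estA_nonneg (g : Fin T → Fin n → Bool) (z : Fin T → Fin (L + 1)) (i : Fin (L + 1))
    (j : Fin n) : 0 ≤ estA g z i j := by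
  rw [estA_eq]; positivity

lemma estA_le_one (g : Fin T → Fin n → Bool) (z : Fin T → Fin (L + 1)) (i : Fin (L + 1))
    (j : Fin n) : estA g z i j ≤ 1 := by
  rw [estA_eq]
  exact div_le_one_of_le₀ (by exact_mod_cast hits_le_count g z i j) (by positivity)

/-- No observation has fitted probability zero, so every logarithm in the profile likelihood is
genuine and can be exponentiated back. -/
lemma bern_estA_pos (g : Fin T → Fin n → Bool) (z : Fin T → Fin (L + 1)) (t : Fin T) (j : Fin n) :
    0 < bern (estA g z (z t) j) (g t j) := by
  have hc : (0 : ℝ) < count z (z t) := by exact_mod_cast count_pos z t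
  cases h : g t j
  · simp only [bern, estA_eq]
    simp only [Bool.false_eq_true, if_false, sub_pos]
    rw [div_lt_one hc]
    have : hits g z (z t) j < count z (z t) := by
      refine Finset.card_lt_card ⟨fun s hs => by simp_all, fun hs => ?_⟩
      have := hs (show t ∈ Finset.univ.filter fun s => z s = z t by simp)
      simp [h] at this
    exact_mod_cast this
  · simp only [bern, estA_eq, if_true]
    refine div_pos ?_ hc
    have : 0 < hits g z (z t) j := Finset.card_pos.2 ⟨t, by simp [h]⟩
    exact_mod_cast this

lemma log_term_eq (g : Fin T → Fin n → Bool) (t : Fin T) (j : Fin n) (p : ℝ) :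
    obs g t j * Real.log p + (1 - obs g t j) * Real.log (1 - p) = Real.log (bern p (g t j)) := by
  cases h : g t j <;> simp [obs, bern, h]

/-- The contribution of the node `j` to the profile log-likelihood. -/
noncomputable def columnLogLik (g : Fin T → Fin n → Bool) (z : Fin T → Fin (L + 1)) (j : Fin n) :
    ℝ :=
  ∑ t, Real.log (bern (estA g z (z t) j) (g t j))

lemma profileLogLik_eq (g : Fin T → Fin n → Bool) (z : Fin T → Fin (L + 1)) :
    profileLogLik g z = ∑ j, columnLogLik g z j := by
  unfold profileLogLik columnLogLik
  rw [Finset.sum_comm]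
  simp_rw [log_term_eq]

lemma columnLogLik_nonpos (g : Fin T → Fin n → Bool) (z : Fin T → Fin (L + 1)) (j : Fin n) :
    columnLogLik g z j ≤ 0 := by
  refine Finset.sum_nonpos fun t _ => Real.log_nonpos (bern_estA_pos g z t j).le ?_
  have h0 := estA_nonneg g z (z t) j
  have h1 := estA_le_one g z (z t) j
  cases g t j <;> simp [bern, h0, h1]

/-- The estimate `Â^z` maximizes the likelihood given the labels `z`. -/
lemma sum_log_bern_le_columnLogLik (g : Fin T → Fin n → Bool) (z : Fin T → Fin (L + 1))
    (j : Fin n) (b : Fin (L + 1) → ℝ) (hb : ∀ i, 0 < b i) (hb' : ∀ i, b i < 1) :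
    ∑ t, Real.log (bern (b (z t)) (g t j)) ≤ columnLogLik g z j := by
  have hbp : ∀ i c, 0 < bern (b i) c := fun i c => by
    cases c <;> simp [bern, hb, hb']
  have h1 : ∀ t, Real.log (bern (b (z t)) (g t j)) -
      Real.log (bern (estA g z (z t) j) (g t j)) ≤
      bern (b (z t)) (g t j) / bern (estA g z (z t) j) (g t j) - 1 := by
    intro t
    rw [← Real.log_div (hbp _ _).ne' (bern_estA_pos g z t j).ne']
    exact Real.log_le_sub_one_of_pos (div_pos (hbp _ _) (bern_estA_pos g z t j))
  -- On a class, the likelihood ratios sum to at most `count * b + count * (1 - b)`, the number of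
  -- terms. Equality can fail only when the estimate is `0` or `1`, where a division by zero gives
  -- `0`.
  have h2 : ∀ i, ∑ t with z t = i,
      (bern (b (z t)) (g t j) / bern (estA g z (z t) j) (g t j) - 1) ≤ 0 := by
    intro i
    have h3 : ∑ t with z t = i,
        (bern (b (z t)) (g t j) / bern (estA g z (z t) j) (g t j) - 1) =
        ∑ t with z t = i, ((if g t j = true then b i / estA g z i j else
          (1 - b i) / (1 - estA g z i j)) - 1) := by
      refine Finset.sum_congr rfl fun t ht => ?_
      rw [(Finset.mem_filter.1 ht).2]
      cases g t j <;> simp [bern]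
    rw [h3, Finset.sum_sub_distrib, Finset.sum_ite]
    simp only [Finset.sum_const, Finset.filter_filter, nsmul_eq_mul, mul_one]
    have e1 : (Finset.univ.filter fun t => z t = i ∧ g t j = true).card = hits g z i j := rfl
    have e2 : (Finset.univ.filter fun t => z t = i).card = count z i := rfl
    have e3 : hits g z i j + (Finset.univ.filter fun t => z t = i ∧ ¬ g t j = true).card =
        count z i := by
      have := Finset.card_filter_add_card_filter_not (s := Finset.univ.filter fun t => z t = i)
        (fun t => g t j = true)
      rw [Finset.filter_filter, Finset.filter_filter] at this
      exact this
    have e3' : ((Finset.univ.filter fun t => z t = i ∧ ¬ g t j = true).card : ℝ) =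
        count z i - hits g z i j := by
      rw [← e3]; push_cast; ring
    rw [e1, e2, e3', estA_eq]
    have hle : (hits g z i j : ℝ) ≤ count z i := by exact_mod_cast hits_le_count g z i j
    have hpos : (0 : ℝ) ≤ hits g z i j := Nat.cast_nonneg _
    generalize (hits g z i j : ℝ) = a at *
    generalize hcn : (count z i : ℝ) = c at *
    have hc : 0 ≤ c := hcn ▸ Nat.cast_nonneg _
    rcases hc.eq_or_lt with rfl | hc
    · obtain rfl : a = 0 := le_antisymm hle hpos
      simp
    have t1 : a * (b i / (a / c)) ≤ b i * c := by
      rcases eq_or_ne a 0 with h | h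
      · rw [h, zero_mul]; exact (mul_pos (hb i) hc).le
      · exact le_of_eq (by field_simp)
    have t2 : (c - a) * ((1 - b i) / (1 - a / c)) ≤ (1 - b i) * c := by
      rcases eq_or_ne (c - a) 0 with h | h
      · rw [h, zero_mul]; exact (mul_pos (by linarith [hb' i]) hc).le
      · have : 1 - a / c = (c - a) / c := by field_simp
        rw [this]
        exact le_of_eq (by field_simp)
    linarith
  have h4 : ∑ t, (Real.log (bern (b (z t)) (g t j)) -
      Real.log (bern (estA g z (z t) j) (g t j))) ≤ 0 := by
    refine (Finset.sum_le_sum fun t _ => h1 t).trans ?_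
    rw [← Finset.sum_fiberwise _ z]
    exact Finset.sum_nonpos fun i _ => h2 i
  rw [Finset.sum_sub_distrib] at h4
  unfold columnLogLik
  linarith


/-! ### Misclassification counts and impurity; `z` plays the estimate and `z'` the truth. -/

/-- The number of groups labelled `i` by `z` and `k` by `z'`. -/
def confusion (z z' : Fin T → Fin (L + 1)) (i k : Fin (L + 1)) : ℕ :=
  (Finset.univ.filter fun t => z t = i ∧ z' t = k).card

lemma sum_confusion (z z' : Fin T → Fin (L + 1)) (i : Fin (L + 1)) :
    ∑ k, confusion z z' i k = count z i := by
  unfold confusion count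
  rw [Finset.card_eq_sum_card_fiberwise (f := z') (t := Finset.univ) (by simp)]
  simp [Finset.filter_filter]

lemma confusion_le_count (z z' : Fin T → Fin (L + 1)) (i k : Fin (L + 1)) :
    confusion z z' i k ≤ count z i :=
  Finset.card_le_card fun t ht => by simp_all

lemma confusion_le_count_right (z z' : Fin T → Fin (L + 1)) (i k : Fin (L + 1)) :
    confusion z z' i k ≤ count z' k :=
  Finset.card_le_card fun t ht => by simp_all

lemma numErrors_eq (z z' : Fin T → Fin (L + 1)) :
    (numErrors z' z : ℝ) = ∑ i, ((count z i : ℝ) - confusion z z' i i) := by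
  have h : numErrors z' z + ∑ i, confusion z z' i i = ∑ i, count z i := by
    have h1 : ∑ i, count z i = T := by
      unfold count
      rw [← Finset.card_eq_sum_card_fiberwise (f := z) (t := Finset.univ) (by simp)]
      simp
    have h2 : ∑ i, confusion z z' i i = (Finset.univ.filter fun t => z' t = z t).card := by
      rw [Finset.card_eq_sum_card_fiberwise (f := z) (t := Finset.univ) (by simp)]
      refine Finset.sum_congr rfl fun i _ => ?_
      unfold confusion
      rw [Finset.filter_filter]
      congr 1
      ext t
      simp
      grind
    have h3 : (Finset.univ.filter fun t => z' t = z t).card + numErrors z' z = T := by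
      have := Finset.card_filter_add_card_filter_not (s := (Finset.univ : Finset (Fin T)))
        (fun t => z' t = z t)
      rwa [Finset.card_univ, Fintype.card_fin] at this
    rw [h1, h2, add_comm, h3]
  rw [Finset.sum_sub_distrib]
  have : (numErrors z' z : ℝ) + ∑ i, (confusion z z' i i : ℝ) = ∑ i, (count z i : ℝ) := by
    exact_mod_cast h
  linarith

/-- How far the groups labelled `i` by `z` are from having a single label under `z'`; the
label `0` is not counted. -/
noncomputable def impurity (z z' : Fin T → Fin (L + 1)) (i : Fin (L + 1)) : ℝ :=
  ∑ k with k ≠ 0, min (confusion z z' i k : ℝ) (count z i - confusion z z' i k)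

lemma impurity_term_nonneg (z z' : Fin T → Fin (L + 1)) (i k : Fin (L + 1)) :
    0 ≤ min (confusion z z' i k : ℝ) (count z i - confusion z z' i k) := by
  have : (confusion z z' i k : ℝ) ≤ count z i := by exact_mod_cast confusion_le_count z z' i k
  exact le_min (by positivity) (by linarith)

lemma impurity_nonneg (z z' : Fin T → Fin (L + 1)) (i : Fin (L + 1)) : 0 ≤ impurity z z' i :=
  Finset.sum_nonneg fun k _ => impurity_term_nonneg z z' i k

lemma sum_confusion_ne_zero (z z' : Fin T → Fin (L + 1)) (i : Fin (L + 1)) :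
    ∑ k with k ≠ 0, (confusion z z' i k : ℝ) = count z i - confusion z z' i 0 := by
  have h : ∑ k, (confusion z z' i k : ℝ) = count z i := by exact_mod_cast sum_confusion z z' i
  rw [← h, ← Finset.sum_filter_add_sum_filter_not Finset.univ (fun k => k ≠ 0)]
  simp [Finset.filter_eq']

lemma impurity_eq_of_forall (z z' : Fin T → Fin (L + 1)) (i : Fin (L + 1))
    (h : ∀ k ≠ 0, 2 * (confusion z z' i k : ℝ) ≤ count z i) :
    impurity z z' i = count z i - confusion z z' i 0 := by
  rw [← sum_confusion_ne_zero]
  exact Finset.sum_congr rfl fun k hk =>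
    min_eq_left (by linarith [h k (Finset.mem_filter.1 hk).2])

/-- If `i` holds the majority of its class, its impurity term is exactly the number of errors. If
another label does, the class has fewer than `2M` members. Without a majority, at least half of the
class counts as impurity. -/
lemma count_sub_confusion_le (z z' : Fin T → Fin (L + 1)) (i : Fin (L + 1)) (hi : i ≠ 0) {M : ℝ}
    (hM : 0 ≤ M) (h : ∀ k, k ≠ i → (confusion z z' i k : ℝ) ≤ M) :
    (count z i : ℝ) - confusion z z' i i ≤ 2 * impurity z z' i + 2 * M := by
  have h0 := impurity_nonneg z z' i
  have hc : (0 : ℝ) ≤ confusion z z' i i := by positivity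
  by_cases h1 : (count z i : ℝ) ≤ 2 * confusion z z' i i
  · have : min (confusion z z' i i : ℝ) (count z i - confusion z z' i i) ≤ impurity z z' i :=
      Finset.single_le_sum (f := fun k => min (confusion z z' i k : ℝ)
        (count z i - confusion z z' i k)) (fun k _ => impurity_term_nonneg z z' i k) (by simp [hi])
    rw [min_eq_right (by linarith)] at this
    linarith
  · by_cases h2 : ∃ k, k ≠ i ∧ (count z i : ℝ) < 2 * confusion z z' i k
    · obtain ⟨k, hk, hk'⟩ := h2
      linarith [h k hk]
    · push Not at h1 h2
      have h3 := impurity_eq_of_forall z z' i fun k _ => by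
        by_cases hk : k = i
        · subst hk; exact h1.le
        · exact h2 k hk
      have := h2 0 hi.symm
      linarith

/-- No hub node certifies the label `0`, so a dominating wrong label is controlled only by its true
count. -/
lemma count_sub_confusion_zero_le (z z' : Fin T → Fin (L + 1)) {N : ℝ} (hN : 0 ≤ N)
    (h : ∀ k, (count z' k : ℝ) ≤ N) :
    (count z 0 : ℝ) - confusion z z' 0 0 ≤ 2 * impurity z z' 0 + 2 * N := by
  have h0 := impurity_nonneg z z' 0
  have hc : (0 : ℝ) ≤ confusion z z' 0 0 := by positivity
  by_cases h2 : ∃ k, (count z 0 : ℝ) < 2 * confusion z z' 0 k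
  · obtain ⟨k, hk⟩ := h2
    have : (confusion z z' 0 k : ℝ) ≤ count z' k := by
      exact_mod_cast confusion_le_count_right z z' 0 k
    linarith [h k]
  · push Not at h2
    have h3 := impurity_eq_of_forall z z' 0 fun k _ => h2 k
    linarith

lemma numErrors_le (z z' : Fin T → Fin (L + 1)) {M N : ℝ} (hM : 0 ≤ M) (hN : 0 ≤ N)
    (h : ∀ i k, i ≠ 0 → k ≠ i → (confusion z z' i k : ℝ) ≤ M)
    (h' : ∀ k, (count z' k : ℝ) ≤ N) :
    (numErrors z' z : ℝ) ≤ 2 * ∑ i, impurity z z' i + 2 * (L * M) + 2 * N := by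
  rw [numErrors_eq, Fin.sum_univ_succ, Fin.sum_univ_succ (fun i => impurity z z' i)]
  have h1 := count_sub_confusion_zero_le z z' hN h'
  have h2 : ∑ i : Fin L, ((count z i.succ : ℝ) - confusion z z' i.succ i.succ) ≤
      ∑ i : Fin L, (2 * impurity z z' i.succ + 2 * M) :=
    Finset.sum_le_sum fun i _ => count_sub_confusion_le z z' i.succ (Fin.succ_ne_zero i) hM
      fun k hk => h _ k (Fin.succ_ne_zero i) hk
  rw [Finset.sum_add_distrib, ← Finset.mul_sum] at h2
  simp only [Finset.sum_const, Finset.card_univ, Fintype.card_fin, nsmul_eq_mul] at h2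
  linarith

/-- The squared distance of the true means from any array that is constant on the classes
of `z`. -/
lemma sum_sq_sub_ge (z z' : Fin T → Fin (L + 1)) (x b : Fin (L + 1) → Fin n → ℝ)
    (V : Fin (L + 1) → Finset (Fin n)) {δ w : ℝ} (hδ : 0 ≤ δ)
    (hV : ∀ k, k ≠ 0 → ∀ k', k' ≠ 0 → k ≠ k' → Disjoint (V k) (V k'))
    (hw : ∀ k, k ≠ 0 → w ≤ (V k).card)
    (hsep : ∀ k, k ≠ 0 → ∀ k', k' ≠ k → ∀ j ∈ V k, x k' j + δ ≤ x k j)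
    (J : Finset (Fin n)) (hJ : ∀ k, k ≠ 0 → V k ⊆ J) :
    w * (δ ^ 2 / 4) * ∑ i, impurity z z' i ≤
      ∑ t, ∑ j ∈ J, (x (z' t) j - b (z t) j) ^ 2 := by
  have hcell : ∀ i k, k ≠ 0 → ∀ j ∈ V k,
      δ ^ 2 / 4 * min (confusion z z' i k : ℝ) (count z i - confusion z z' i k) ≤
        ∑ t with z t = i, (x (z' t) j - b (z t) j) ^ 2 := by
    intro i k hk j hj
    have hsplit := Finset.card_filter_add_card_filter_not (s := Finset.univ.filter fun t => z t = i)
        (fun t => z' t = k)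
    have e1 : ((Finset.univ.filter fun t => z t = i).filter fun t => z' t = k).card =
        confusion z z' i k := by rw [Finset.filter_filter]; rfl
    have e2 : (Finset.univ.filter fun t => z t = i).card = count z i := rfl
    rw [e1, e2] at hsplit
    have hsplit' : (confusion z z' i k : ℝ) +
      ((Finset.univ.filter fun t => z t = i).filter fun t => ¬ z' t = k).card = count z i := by
      exact_mod_cast hsplit
    -- The threshold is the middle of the gap: the common value `b i j` is off by at least `δ / 2`
    -- either on all groups of true label `k` or on all the others.
    by_cases hb : b i j ≤ x k j - δ / 2
    · calc _ ≤ δ ^ 2 / 4 * (confusion z z' i k : ℝ) :=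
            mul_le_mul_of_nonneg_left (min_le_left _ _) (by positivity)
        _ = ∑ t ∈ (Finset.univ.filter fun t => z t = i).filter fun t => z' t = k, δ ^ 2 / 4 := by
            rw [Finset.sum_const, e1, nsmul_eq_mul, mul_comm]
        _ ≤ ∑ t ∈ (Finset.univ.filter fun t => z t = i).filter fun t => z' t = k,
              (x (z' t) j - b (z t) j) ^ 2 := by
            refine Finset.sum_le_sum fun t ht => ?_
            simp only [Finset.mem_filter, Finset.mem_univ, true_and] at ht
            rw [ht.1, ht.2]
            nlinarith
        _ ≤ _ := Finset.sum_le_sum_of_subset_of_nonneg (Finset.filter_subset _ _)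
            fun _ _ _ => sq_nonneg _
    · calc _ ≤ δ ^ 2 / 4 * ((count z i : ℝ) - confusion z z' i k) :=
            mul_le_mul_of_nonneg_left (min_le_right _ _) (by positivity)
        _ = ∑ t ∈ (Finset.univ.filter fun t => z t = i).filter fun t => ¬ z' t = k, δ ^ 2 / 4 := by
            rw [Finset.sum_const, nsmul_eq_mul, ← hsplit']; ring
        _ ≤ ∑ t ∈ (Finset.univ.filter fun t => z t = i).filter fun t => ¬ z' t = k,
              (x (z' t) j - b (z t) j) ^ 2 := by
            refine Finset.sum_le_sum fun t ht => ?_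
            simp only [Finset.mem_filter, Finset.mem_univ, true_and] at ht
            have := hsep k hk (z' t) ht.2 j hj
            rw [ht.1]
            nlinarith
        _ ≤ _ := Finset.sum_le_sum_of_subset_of_nonneg (Finset.filter_subset _ _)
            fun _ _ _ => sq_nonneg _
  have hgroup : ∀ i, w * (δ ^ 2 / 4) * impurity z z' i ≤
      ∑ t with z t = i, ∑ j ∈ J, (x (z' t) j - b (z t) j) ^ 2 := by
    intro i
    rw [Finset.sum_comm, impurity, Finset.mul_sum]
    calc _ ≤ ∑ k with k ≠ 0, ∑ j ∈ V k, ∑ t with z t = i, (x (z' t) j - b (z t) j) ^ 2 := by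
          refine Finset.sum_le_sum fun k hk => ?_
          have hk := (Finset.mem_filter.1 hk).2
          refine le_trans ?_ (Finset.card_nsmul_le_sum _ _ _ (hcell i k hk))
          rw [nsmul_eq_mul, mul_assoc]
          exact mul_le_mul_of_nonneg_right (hw k hk)
            (mul_nonneg (by positivity) (impurity_term_nonneg z z' i k))
      _ = ∑ j ∈ (Finset.univ.filter fun k : Fin (L + 1) => k ≠ 0).biUnion V,
            ∑ t with z t = i, (x (z' t) j - b (z t) j) ^ 2 := by
          rw [Finset.sum_biUnion]
          intro k hk k' hk' hne
          exact hV k (by simpa using hk) k' (by simpa using hk') hne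
      _ ≤ _ := by
          refine Finset.sum_le_sum_of_subset_of_nonneg ?_
            fun _ _ _ => Finset.sum_nonneg fun _ _ => sq_nonneg _
          exact Finset.biUnion_subset.2 fun k hk => hJ k (Finset.mem_filter.1 hk).2
  rw [Finset.mul_sum, ← Finset.sum_fiberwise _ z]
  exact Finset.sum_le_sum fun i _ => hgroup i


/-! ### Probability of many errors given the true labels. -/

lemma sum_biUnion_le_of_nonneg {ι α : Type*} [DecidableEq α] (s : Finset ι) (E : ι → Finset α)
    {f : α → ℝ} (hf : ∀ a, 0 ≤ f a) : ∑ a ∈ s.biUnion E, f a ≤ ∑ i ∈ s, ∑ a ∈ E i, f a := by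
  classical
  induction s using Finset.induction_on with
  | empty => simp
  | insert i s hi ih =>
    rw [Finset.biUnion_insert, Finset.sum_insert hi]
    refine le_trans ?_ (add_le_add_right ih _)
    rw [← Finset.sum_union_inter]
    exact le_add_of_nonneg_right (Finset.sum_nonneg fun a _ => hf a)

lemma card_hub_le : (Finset.univ.filter fun j : Fin n => ¬ L ≤ (j : ℕ)).card ≤ L := by
  rw [← Finset.card_range L]
  refine Finset.card_le_card_of_injOn (fun j => (j : ℕ)) (fun j hj => ?_)
    fun a _ b _ h => Fin.ext h
  simpa using hj

lemma neg_log_two_le_columnLogLik (g : Fin T → Fin n → Bool) (z : Fin T → Fin (L + 1))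
    (j : Fin n) : -(T * Real.log 2) ≤ columnLogLik g z j := by
  refine le_trans (le_of_eq ?_) (sum_log_bern_le_columnLogLik g z j (fun _ => 1 / 2)
    (fun _ => by norm_num) fun _ => by norm_num)
  have : ∀ b, Real.log (bern (1 / 2) b) = -Real.log 2 := by
    intro b
    cases b <;> norm_num [bern, ← Real.log_inv]
  simp only [this, Finset.sum_const, Finset.card_univ, Fintype.card_fin, nsmul_eq_mul, mul_neg]

/-- The true means in the columns of the hubs, the estimate in the other columns. -/
noncomputable def mixedMeans (A : Fin (L + 1) → Fin n → ℝ) (z zh : Fin T → Fin (L + 1))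
    (B : Fin (L + 1) → Fin n → ℝ) (t : Fin T) (j : Fin n) : ℝ :=
  if L ≤ (j : ℕ) then B (zh t) j else A (z t) j

/-- The true means are a competitor to the fitted ones only where they lie strictly in `(0, 1)`,
which `A_ii = 1` rules out in hub columns. There both laws use the true means, and the factor pays
for the missing comparison. -/
lemma groupProb_le_of_isProfileMLE {A : Fin (L + 1) → Fin n → ℝ} (h0 : ∀ i j, 0 ≤ A i j)
    (h1 : ∀ i j, A i j ≤ 1) (hpos : ∀ i (j : Fin n), L ≤ (j : ℕ) → 0 < A i j)
    (hlt : ∀ i (j : Fin n), L ≤ (j : ℕ) → A i j < 1) {g : Fin T → Fin n → Bool}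
    {z zh : Fin T → Fin (L + 1)} (hz : Feasible g z) (hzh : IsProfileMLE g zh) :
    groupProb (fun t j => A (z t) j) g ≤
      Real.exp (T * L * Real.log 2) * groupProb (mixedMeans A z zh (estA g zh)) g := by
  have hlik := hzh.2 z hz
  rw [profileLogLik_eq, profileLogLik_eq,
    ← Finset.sum_filter_add_sum_filter_not Finset.univ (fun j : Fin n => L ≤ (j : ℕ)),
    ← Finset.sum_filter_add_sum_filter_not Finset.univ (fun j : Fin n => L ≤ (j : ℕ))] at hlik
  have hhub : -(T * L * Real.log 2) ≤ ∑ j : Fin n with ¬ L ≤ j.val, columnLogLik g z j := by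
    have h := Finset.card_nsmul_le_sum (Finset.univ.filter fun j : Fin n => ¬ L ≤ (j : ℕ))
      (columnLogLik g z) _ fun j _ => neg_log_two_le_columnLogLik g z j
    refine le_trans ?_ h
    rw [nsmul_eq_mul]
    have h2 : ((Finset.univ.filter fun j : Fin n => ¬ L ≤ (j : ℕ)).card : ℝ) ≤ L := by
      exact_mod_cast card_hub_le
    have h3 : 0 ≤ T * Real.log 2 := by positivity
    nlinarith
  have hhub' : ∑ j : Fin n with ¬ L ≤ j.val, columnLogLik g zh j ≤ 0 :=
    Finset.sum_nonpos fun j _ => columnLogLik_nonpos g zh j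
  have hA : ∑ j : Fin n with L ≤ j.val, ∑ t, Real.log (bern (A (z t) j) (g t j)) ≤
      ∑ j : Fin n with L ≤ j.val, columnLogLik g z j := by
    refine Finset.sum_le_sum fun j hj => ?_
    have hj := (Finset.mem_filter.1 hj).2
    exact sum_log_bern_le_columnLogLik g z j (fun i => A i j) (fun i => hpos i j hj)
      fun i => hlt i j hj
  have hbp : ∀ t (j : Fin n), L ≤ (j : ℕ) → 0 < bern (A (z t) j) (g t j) := fun t j hj => by
    cases g t j <;> simp [bern, hpos _ j hj, hlt _ j hj]
  unfold groupProb
  rw [Finset.prod_comm, Finset.prod_comm (f := fun t j => bern (mixedMeans A z zh _ t j) _),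
    ← Finset.prod_filter_mul_prod_filter_not Finset.univ (fun j : Fin n => L ≤ (j : ℕ)),
    ← Finset.prod_filter_mul_prod_filter_not Finset.univ (fun j : Fin n => L ≤ (j : ℕ))
      (fun j => ∏ t, bern (mixedMeans A z zh _ t j) _), ← mul_assoc]
  have e1 : ∏ j : Fin n with ¬ L ≤ j.val, ∏ t, bern (mixedMeans A z zh (estA g zh) t j) (g t j) =
      ∏ j : Fin n with ¬ L ≤ j.val, ∏ t, bern (A (z t) j) (g t j) :=
    Finset.prod_congr rfl fun j hj => Finset.prod_congr rfl fun t _ => by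
      rw [mixedMeans, if_neg (Finset.mem_filter.1 hj).2]
  have e2 : ∏ j : Fin n with L ≤ j.val, ∏ t, bern (mixedMeans A z zh (estA g zh) t j) (g t j) =
      Real.exp (∑ j : Fin n with L ≤ j.val, columnLogLik g zh j) := by
    rw [Real.exp_sum]
    refine Finset.prod_congr rfl fun j hj => ?_
    rw [columnLogLik, Real.exp_sum]
    refine Finset.prod_congr rfl fun t _ => ?_
    rw [Real.exp_log (bern_estA_pos g zh t j), mixedMeans, if_pos (Finset.mem_filter.1 hj).2]
  have e3 : ∏ j : Fin n with L ≤ j.val, ∏ t, bern (A (z t) j) (g t j) =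
      Real.exp (∑ j : Fin n with L ≤ j.val, ∑ t, Real.log (bern (A (z t) j) (g t j))) := by
    rw [Real.exp_sum]
    refine Finset.prod_congr rfl fun j hj => ?_
    rw [Real.exp_sum]
    exact Finset.prod_congr rfl fun t _ =>
      (Real.exp_log (hbp t j (Finset.mem_filter.1 hj).2)).symm
  rw [e1, e2, e3, ← Real.exp_add]
  refine mul_le_mul_of_nonneg_right (Real.exp_le_exp.2 (by linarith))
    (Finset.prod_nonneg fun j _ => Finset.prod_nonneg fun t _ => bern_nonneg (h0 _ _) (h1 _ _) _)

/-- The groups for which some maximum profile likelihood estimate is off by at least `e`. -/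
noncomputable def badGroups (n : ℕ) (z : Fin T → Fin (L + 1)) (e : ℝ) :
    Finset (Fin T → Fin n → Bool) := by
  classical
  exact Finset.univ.filter fun g =>
    Feasible g z ∧ ∃ zh : Fin T → Fin (L + 1), IsProfileMLE g zh ∧ e ≤ numErrors z zh

lemma mem_badGroups {z : Fin T → Fin (L + 1)} {e : ℝ} {g : Fin T → Fin n → Bool} :
    g ∈ badGroups n z e ↔
      Feasible g z ∧ ∃ zh : Fin T → Fin (L + 1), IsProfileMLE g zh ∧ e ≤ numErrors z zh := by
  simp [badGroups]

/-- The candidate value `a / t_i` of the estimate. -/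
noncomputable def ratio (zh : Fin T → Fin (L + 1)) (a : Fin (L + 1) → Fin n → Fin (T + 1))
    (i : Fin (L + 1)) (j : Fin n) : ℝ :=
  min (((a i j : ℕ) : ℝ) / count zh i) 1

/-- The cap at `1`, which keeps arbitrary candidates probabilities, is inactive for actual counts;
so the random estimate is one of finitely many fixed candidates. -/
lemma ratio_hits (g : Fin T → Fin n → Bool) (zh : Fin T → Fin (L + 1)) :
    ratio zh (fun i j => ⟨hits g zh i j, Nat.lt_succ_of_le (hits_le g zh i j)⟩) = estA g zh := by
  funext i j
  have := estA_le_one g zh i j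
  rw [ratio, estA_eq]
  rw [estA_eq] at this
  exact min_eq_left this

lemma ratio_nonneg (zh : Fin T → Fin (L + 1)) (a : Fin (L + 1) → Fin n → Fin (T + 1))
    (i : Fin (L + 1)) (j : Fin n) : 0 ≤ ratio zh a i j :=
  le_min (by positivity) zero_le_one

lemma ratio_le_one (zh : Fin T → Fin (L + 1)) (a : Fin (L + 1) → Fin n → Fin (T + 1))
    (i : Fin (L + 1)) (j : Fin n) : ratio zh a i j ≤ 1 := min_le_right _ _

/-- Bound, given the true labels, on the probability of many errors. -/
lemma sum_badGroups_le {A : Fin (L + 1) → Fin n → ℝ} (hLn : L < n) (h0 : ∀ i j, 0 ≤ A i j)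
    (h1 : ∀ i j, A i j ≤ 1) (hpos : ∀ i (j : Fin n), L ≤ (j : ℕ) → 0 < A i j)
    (hlt : ∀ i (j : Fin n), L ≤ (j : ℕ) → A i j < 1) (z : Fin T → Fin (L + 1))
    (V : Fin (L + 1) → Finset (Fin n)) {δ w c M N e : ℝ} (hδ : 0 ≤ δ) (hw0 : 0 ≤ w)
    (hV : ∀ k, k ≠ 0 → ∀ k', k' ≠ 0 → k ≠ k' → Disjoint (V k) (V k'))
    (hVL : ∀ k, k ≠ 0 → ∀ j ∈ V k, L ≤ (j : ℕ))
    (hw : ∀ k, k ≠ 0 → w ≤ (V k).card)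
    (hsep : ∀ k, k ≠ 0 → ∀ k', k' ≠ k → ∀ j ∈ V k, √(A k' j) + δ ≤ √(A k j))
    (hc : 0 ≤ c) (hhub : ∀ i (j : Fin n), (j : ℕ) < L → ¬ IsNode i j → A i j ≤ c)
    (hM : 0 ≤ M) (hN : 0 ≤ N) (hcount : ∀ k, (count z k : ℝ) ≤ N) :
    ∑ g ∈ badGroups n z e, groupProb (fun t j => A (z t) j) g ≤
      ((L : ℝ) + 1) ^ 2 * Real.exp (2 * (N * c) - M) +
      ((L : ℝ) + 1) ^ T * (((T : ℝ) + 1) ^ n) ^ (L + 1) *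
        Real.exp (T * L * Real.log 2 / 2 - w * δ ^ 2 / 16 * (e - 2 * (L * M) - 2 * N)) := by
  classical
  set P : (Fin T → Fin n → Bool) → ℝ := groupProb (fun t j => A (z t) j) with hP
  have hP0 : ∀ g, 0 ≤ P g := groupProb_nonneg (fun _ _ => h0 _ _) fun _ _ => h1 _ _
  -- many groups contain a hub that is not theirs
  let I : Fin (L + 1) → Finset (Fin T) := fun k => Finset.univ.filter fun t => z t = k
  let S : Finset (Fin (L + 1) × Fin (L + 1)) :=
    Finset.univ.filter fun ik => ik.1 ≠ 0 ∧ ik.2 ≠ ik.1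
  let E₁ : Fin (L + 1) × Fin (L + 1) → Finset (Fin T → Fin n → Bool) := fun ik =>
    Finset.univ.filter fun g => ∃ j : Fin n, IsNode ik.1 j ∧
      M ≤ (((I ik.2).filter fun t => g t j = true).card : ℝ)
  -- another labelling fits about as well as the truth
  let Q : Finset ((Fin T → Fin (L + 1)) × (Fin (L + 1) → Fin n → Fin (T + 1))) :=
    Finset.univ.filter fun r => e ≤ numErrors z r.1 ∧
      ∀ i k, i ≠ 0 → k ≠ i → (confusion r.1 z i k : ℝ) ≤ M
  let E₂ : (Fin T → Fin (L + 1)) × (Fin (L + 1) → Fin n → Fin (T + 1)) →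
      Finset (Fin T → Fin n → Bool) := fun r =>
    Finset.univ.filter fun g => P g ≤ Real.exp (T * L * Real.log 2) *
      groupProb (mixedMeans A z r.1 (ratio r.1 r.2)) g
  have hcover : badGroups n z e ⊆ S.biUnion E₁ ∪ Q.biUnion E₂ := by
    intro g hg
    obtain ⟨hz, zh, hzh, he⟩ := mem_badGroups.1 hg
    rw [Finset.mem_union]
    by_cases hconf : ∀ i k, i ≠ 0 → k ≠ i → (confusion zh z i k : ℝ) ≤ M
    · right
      refine Finset.mem_biUnion.2
        ⟨(zh, fun i j => ⟨hits g zh i j, Nat.lt_succ_of_le (hits_le g zh i j)⟩), ?_, ?_⟩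
      · simpa [Q] using ⟨he, hconf⟩
      · simp only [E₂, Finset.mem_filter, Finset.mem_univ, true_and]
        rw [ratio_hits]
        exact groupProb_le_of_isProfileMLE h0 h1 hpos hlt hz hzh
    · left
      push Not at hconf
      obtain ⟨i, k, hi, hk, hik⟩ := hconf
      refine Finset.mem_biUnion.2 ⟨(i, k), by simp [S, hi, hk], ?_⟩
      have hi0 : 0 < (i : ℕ) := Nat.pos_of_ne_zero fun h => hi (Fin.ext h)
      have hiL := i.isLt
      simp only [E₁, Finset.mem_filter, Finset.mem_univ, true_and]
      -- By feasibility, node `i` appears in all groups estimated as `i`, in particular in the more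
      -- than `M` of them with true label `k`.
      have hnode : IsNode i (⟨(i : ℕ) - 1, by omega⟩ : Fin n) := by
        simp only [IsNode]; omega
      refine ⟨_, hnode, hik.le.trans ?_⟩
      unfold confusion
      norm_cast
      refine Finset.card_le_card fun t ht => ?_
      simp only [Finset.mem_filter, Finset.mem_univ, true_and, I] at ht ⊢
      refine ⟨ht.2, hzh.1 t _ ?_⟩
      rw [ht.1]
      exact hnode
  have hE₁ : ∀ ik ∈ S, ∑ g ∈ E₁ ik, P g ≤ Real.exp (2 * (N * c) - M) := by
    rintro ⟨i, k⟩ hik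
    simp only [S, Finset.mem_filter, Finset.mem_univ, true_and] at hik
    have hi0 : 0 < (i : ℕ) := Nat.pos_of_ne_zero fun h => hik.1 (Fin.ext h)
    have hiL := i.isLt
    obtain ⟨j, hj⟩ : ∃ j : Fin n, IsNode i j := ⟨⟨(i : ℕ) - 1, by omega⟩, by
      simp only [IsNode]; omega⟩
    have hj' : (i : ℕ) = (j : ℕ) + 1 := hj
    have hsub : E₁ (i, k) ⊆ Finset.univ.filter fun g : Fin T → Fin n → Bool =>
        M ≤ (((I k).filter fun t => g t j = true).card : ℝ) := by
      intro g hg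
      simp only [E₁, Finset.mem_filter, Finset.mem_univ, true_and] at hg ⊢
      obtain ⟨j', hj'', h⟩ := hg
      have : j' = j := by
        have h2 : (i : ℕ) = (j' : ℕ) + 1 := hj''
        exact Fin.ext (by omega)
      rwa [this] at h
    refine (Finset.sum_le_sum_of_subset_of_nonneg hsub fun g _ _ => hP0 g).trans ?_
    refine (sum_groupProb_appear_le (fun _ _ => h0 _ _) (fun _ _ => h1 _ _) (I k) j c M
      fun t ht => ?_).trans ?_
    · refine hhub _ j (by omega) fun h => ?_
      have ht : z t = k := (Finset.mem_filter.1 ht).2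
      have h : (z t : ℕ) = (j : ℕ) + 1 := h
      rw [ht] at h
      exact hik.2 (Fin.ext (by omega))
    · have := mul_le_mul_of_nonneg_right (hcount k) hc
      exact Real.exp_le_exp.2 (sub_le_sub_right (mul_le_mul_of_nonneg_left this (by norm_num)) _)
  have hE₂ : ∀ r ∈ Q, ∑ g ∈ E₂ r, P g ≤
      Real.exp (T * L * Real.log 2 / 2 - w * δ ^ 2 / 16 * (e - 2 * (L * M) - 2 * N)) := by
    rintro ⟨zh, a⟩ hr
    simp only [Q, Finset.mem_filter, Finset.mem_univ, true_and] at hr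
    have hq0 : ∀ t j, 0 ≤ mixedMeans A z zh (ratio zh a) t j := fun t j => by
      unfold mixedMeans; split_ifs
      exacts [ratio_nonneg _ _ _ _, h0 _ _]
    have hq1 : ∀ t j, mixedMeans A z zh (ratio zh a) t j ≤ 1 := fun t j => by
      unfold mixedMeans; split_ifs
      exacts [ratio_le_one _ _ _ _, h1 _ _]
    refine (sum_groupProb_likelihood_le (fun _ _ => h0 _ _) (fun _ _ => h1 _ _) hq0 hq1
      (T * L * Real.log 2) (E₂ (zh, a)) fun g hg => (Finset.mem_filter.1 hg).2).trans ?_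
    refine Real.exp_le_exp.2 (sub_le_sub_left ?_ _)
    have hs := sum_sq_sub_ge zh z (fun i j => √(A i j)) (fun i j => √(ratio zh a i j)) V hδ hV hw
      hsep (Finset.univ.filter fun j => L ≤ (j : ℕ)) fun k hk j hj => by simpa using hVL k hk j hj
    have hs' : ∑ t, ∑ j : Fin n with L ≤ j.val, (√(A (z t) j) - √(ratio zh a (zh t) j)) ^ 2 ≤
        ∑ t, ∑ j, (√(A (z t) j) - √(mixedMeans A z zh (ratio zh a) t j)) ^ 2 := by
      refine Finset.sum_le_sum fun t _ => ?_
      rw [Finset.sum_congr rfl (g := fun j =>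
        (√(A (z t) j) - √(mixedMeans A z zh (ratio zh a) t j)) ^ 2) fun j hj => by
          rw [mixedMeans, if_pos (Finset.mem_filter.1 hj).2]]
      exact Finset.sum_le_sum_of_subset_of_nonneg (Finset.filter_subset _ _)
        fun _ _ _ => sq_nonneg _
    have hnum := numErrors_le zh z hM hN hr.2 hcount
    have hwδ : 0 ≤ w * (δ ^ 2 / 4) := by positivity
    -- The `16` of the exponent is `4` from the separation, `2` from here and `2` from the affinity
    -- bound.
    have hl : (e - 2 * (L * M) - 2 * N) / 2 ≤ ∑ i, impurity zh z i := by linarith [hr.1]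
    have := mul_le_mul_of_nonneg_left hl hwδ
    linarith
  have hcardS : (S.card : ℝ) ≤ ((L : ℝ) + 1) ^ 2 := by
    have : S.card ≤ (L + 1) ^ 2 :=
      (Finset.card_le_univ S).trans (by simp [sq])
    exact_mod_cast this
  have hcardQ : (Q.card : ℝ) ≤ ((L : ℝ) + 1) ^ T * (((T : ℝ) + 1) ^ n) ^ (L + 1) := by
    have : Q.card ≤ (L + 1) ^ T * ((T + 1) ^ n) ^ (L + 1) :=
      (Finset.card_le_univ Q).trans (by simp)
    exact_mod_cast this
  calc ∑ g ∈ badGroups n z e, P g ≤ ∑ g ∈ S.biUnion E₁ ∪ Q.biUnion E₂, P g :=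
        Finset.sum_le_sum_of_subset_of_nonneg hcover fun g _ _ => hP0 g
    _ ≤ ∑ g ∈ S.biUnion E₁, P g + ∑ g ∈ Q.biUnion E₂, P g := by
        rw [← Finset.sum_union_inter]
        exact le_add_of_nonneg_right (Finset.sum_nonneg fun g _ => hP0 g)
    _ ≤ ∑ ik ∈ S, ∑ g ∈ E₁ ik, P g + ∑ r ∈ Q, ∑ g ∈ E₂ r, P g :=
        add_le_add (sum_biUnion_le_of_nonneg _ _ hP0)
          (sum_biUnion_le_of_nonneg _ _ hP0)
    _ ≤ S.card • Real.exp (2 * (N * c) - M) + Q.card • Real.exp (T * L * Real.log 2 / 2 -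
          w * δ ^ 2 / 16 * (e - 2 * (L * M) - 2 * N)) :=
        add_le_add (Finset.sum_le_card_nsmul _ _ _ hE₁) (Finset.sum_le_card_nsmul _ _ _ hE₂)
    _ ≤ _ := by
        rw [nsmul_eq_mul, nsmul_eq_mul]
        exact add_le_add (mul_le_mul_of_nonneg_right hcardS (Real.exp_pos _).le)
          (mul_le_mul_of_nonneg_right hcardQ (Real.exp_pos _).le)


end

/-! ### Averaging over the true labels. -/

lemma jointProb_eq {L n T : ℕ} (ρ : Fin (L + 1) → ℝ) (A : Fin (L + 1) → Fin n → ℝ)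
    (z : Fin T → Fin (L + 1)) (g : Fin T → Fin n → Bool) :
    jointProb ρ A z g = (∏ t, ρ (z t)) * groupProb (fun t j => A (z t) j) g := by
  simp only [jointProb, groupProb, bern, Finset.prod_mul_distrib]

lemma sum_prod_label {L T : ℕ} {ρ : Fin (L + 1) → ℝ} (h : ∑ i, ρ i = 1) :
    ∑ z : Fin T → Fin (L + 1), ∏ t, ρ (z t) = 1 := by
  have := Finset.prod_univ_sum (fun _ : Fin T => (Finset.univ : Finset (Fin (L + 1))))
    (fun _ i => ρ i)
  simpa only [Fintype.piFinset_univ, h, Finset.prod_const_one] using this.symm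

lemma jointProb_eq_zero_of_not_feasible {L n T : ℕ} {ρ : Fin (L + 1) → ℝ}
    {A : Fin (L + 1) → Fin n → ℝ} (hA : IsParam ρ A) {z : Fin T → Fin (L + 1)}
    {g : Fin T → Fin n → Bool} (h : ¬ Feasible g z) : jointProb ρ A z g = 0 := by
  unfold Feasible at h
  push Not at h
  obtain ⟨t, j, hj, hg⟩ := h
  refine Finset.prod_eq_zero (Finset.mem_univ t) ?_
  rw [Finset.prod_eq_zero (Finset.mem_univ j), mul_zero]
  rw [if_neg hg, hA.self _ _ hj, sub_self]

/-- The error event is covered by events `{zs = z, G = g}` of known mass, so `zhat` need not be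
measurable. Infeasible pairs have mass zero. -/
lemma measure_numErrors_le {Ω : Type*} [MeasurableSpace Ω] {μ : Measure Ω} {L n T : ℕ}
    {ρ : Fin (L + 1) → ℝ} {A : Fin (L + 1) → Fin n → ℝ} {zs : Ω → Fin T → Fin (L + 1)}
    {G : Ω → Fin T → Fin n → Bool} (hmodel : IsHubModel μ ρ A zs G)
    {zhat : Ω → Fin T → Fin (L + 1)} (hzhat : ∀ ω, IsProfileMLE (G ω) (zhat ω))
    (H : (Fin T → Fin (L + 1)) → Prop) (e η : ℝ)
    (hη : ∀ z, H z → ∑ g ∈ badGroups n z e, groupProb (fun t j => A (z t) j) g ≤ η) (hη0 : 0 ≤ η) :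
    μ {ω | e ≤ numErrors (zs ω) (zhat ω)} ≤ μ {ω | H (zs ω)}ᶜ + ENNReal.ofReal η := by
  classical
  have hp := hmodel.param
  let F : (Fin T → Fin (L + 1)) → (Fin T → Fin n → Bool) → Set Ω :=
    fun z g => {ω | zs ω = z ∧ G ω = g}
  let Z : Finset (Fin T → Fin (L + 1)) := Finset.univ.filter H
  let K : (Fin T → Fin (L + 1)) → Finset (Fin T → Fin n → Bool) := fun z =>
    Finset.univ.filter (fun g => ¬ Feasible g z) ∪ badGroups n z e
  have hJ0 : ∀ (z : Fin T → Fin (L + 1)) (g : Fin T → Fin n → Bool), 0 ≤ jointProb ρ A z g := fun z g => by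
    rw [jointProb_eq]
    exact mul_nonneg (Finset.prod_nonneg fun _ _ => hp.rho_nonneg _)
      (groupProb_nonneg (fun _ _ => hp.nonneg _ _) (fun _ _ => hp.le_one _ _) g)
  have hcover : {ω | e ≤ numErrors (zs ω) (zhat ω)} ⊆
      {ω | H (zs ω)}ᶜ ∪ ⋃ z ∈ Z, ⋃ g ∈ K z, F z g := by
    intro ω hω
    by_cases h : H (zs ω)
    · right
      refine Set.mem_biUnion (x := zs ω) (by simpa [Z] using h)
        (Set.mem_biUnion (x := G ω) ?_ ⟨rfl, rfl⟩)
      by_cases hf : Feasible (G ω) (zs ω)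
      · exact Finset.mem_coe.2 (Finset.mem_union_right _
          (mem_badGroups.2 ⟨hf, zhat ω, hzhat ω, hω⟩))
      · exact Finset.mem_coe.2 (Finset.mem_union_left _ (by simpa using hf))
    · exact Or.inl h
  refine (measure_mono hcover).trans ((measure_union_le _ _).trans (add_le_add le_rfl ?_))
  calc μ (⋃ z ∈ Z, ⋃ g ∈ K z, F z g) ≤ ∑ z ∈ Z, ∑ g ∈ K z, μ (F z g) :=
        (measure_biUnion_finset_le _ _).trans
          (Finset.sum_le_sum fun z _ => measure_biUnion_finset_le _ _)
    _ = ENNReal.ofReal (∑ z ∈ Z, ∑ g ∈ K z, jointProb ρ A z g) := by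
        rw [ENNReal.ofReal_sum_of_nonneg fun z _ => Finset.sum_nonneg fun g _ => hJ0 z g]
        refine Finset.sum_congr rfl fun z _ => ?_
        rw [ENNReal.ofReal_sum_of_nonneg fun g _ => hJ0 z g]
        exact Finset.sum_congr rfl fun g _ => hmodel.law z g
    _ ≤ ENNReal.ofReal η := by
        refine ENNReal.ofReal_le_ofReal ?_
        calc ∑ z ∈ Z, ∑ g ∈ K z, jointProb ρ A z g ≤ ∑ z ∈ Z, (∏ t, ρ (z t)) * η := by
              refine Finset.sum_le_sum fun z hz => ?_
              have h1 : ∑ g ∈ K z, jointProb ρ A z g ≤ ∑ g ∈ badGroups n z e, jointProb ρ A z g := by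
                have h2 : ∑ g with ¬ Feasible g z, jointProb ρ A z g = 0 :=
                  Finset.sum_eq_zero fun g hg =>
                    jointProb_eq_zero_of_not_feasible hp (Finset.mem_filter.1 hg).2
                rw [← zero_add (∑ g ∈ badGroups n z e, jointProb ρ A z g), ← h2,
                  ← Finset.sum_union_inter]
                exact le_add_of_nonneg_right (Finset.sum_nonneg fun g _ => hJ0 z g)
              refine h1.trans ?_
              simp_rw [jointProb_eq]
              rw [← Finset.mul_sum]
              exact mul_le_mul_of_nonneg_left (hη z (Finset.mem_filter.1 hz).2)
                (Finset.prod_nonneg fun _ _ => hp.rho_nonneg _)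
          _ ≤ ∑ z : Fin T → Fin (L + 1), (∏ t, ρ (z t)) * η :=
              Finset.sum_le_sum_of_subset_of_nonneg (Finset.subset_univ _) fun z _ _ =>
                mul_nonneg (Finset.prod_nonneg fun _ _ => hp.rho_nonneg _) hη0
          _ = η := by rw [← Finset.sum_mul, sum_prod_label hp.rho_sum, one_mul]

/-! ### Numerical estimates and the bound for a single model. -/

lemma sqrt_add_le_sqrt {x y τ S : ℝ} (hy : 0 ≤ y) (hxy : y + τ ≤ x) (hx : x ≤ S) (hS : 0 < S)
    (hτ : 0 ≤ τ) : √y + τ / (2 * √S) ≤ √x := by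
  have hS' := Real.sqrt_pos.2 hS
  have h1 : √x ≤ √S := Real.sqrt_le_sqrt hx
  have h2 : √y ≤ √x := Real.sqrt_le_sqrt (by linarith)
  have h3 := Real.sq_sqrt hy
  have h4 := Real.sq_sqrt (show 0 ≤ x by linarith)
  rw [← le_sub_iff_add_le', div_le_iff₀ (by positivity)]
  nlinarith

/-- The `L` disjoint sets fit into `n` nodes. This is what allows `v²` to be replaced by `v` in the
rates. -/
lemma le_one_of_disjoint {L n : ℕ} (hL : 0 < L) (hn : 0 < n) {v : ℝ}
    (V : Fin (L + 1) → Finset (Fin n))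
    (hV : ∀ k, k ≠ 0 → ∀ k', k' ≠ 0 → k ≠ k' → Disjoint (V k) (V k'))
    (hcard : ∀ k, k ≠ 0 → v * n / L ≤ (V k).card) : v ≤ 1 := by
  have hL' : (0 : ℝ) < L := by exact_mod_cast hL
  have hn' : (0 : ℝ) < n := by exact_mod_cast hn
  have h1 : ((Finset.univ : Finset (Fin L)).biUnion fun k => V k.succ).card =
      ∑ k : Fin L, (V k.succ).card :=
    Finset.card_biUnion fun a _ b _ h => hV _ (Fin.succ_ne_zero a) _ (Fin.succ_ne_zero b)
      fun h' => h (Fin.succ_injective _ h')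
  have h2 : ∑ k : Fin L, (V k.succ).card ≤ n := by
    rw [← h1]; exact (Finset.card_le_univ _).trans (by simp)
  have h3 : ∑ k : Fin L, v * n / L ≤ ∑ k : Fin L, ((V k.succ).card : ℝ) :=
    Finset.sum_le_sum fun k _ => hcard _ (Fin.succ_ne_zero k)
  have h4 : ∑ k : Fin L, ((V k.succ).card : ℝ) ≤ n := by exact_mod_cast h2
  simp only [Finset.sum_const, Finset.card_univ, Fintype.card_fin, nsmul_eq_mul] at h3
  have h5 : (L : ℝ) * (v * n / L) = v * n := by field_simp
  rw [h5] at h3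
  exact le_of_mul_le_mul_right (by linarith) hn'

lemma card_sq_mul_exp_le {L T : ℝ} (hL : 1 ≤ L) (hT : 0 < T) :
    (L + 1) ^ 2 * Real.exp (-(T / L ^ 2)) ≤ 4 * (L ^ 4 / T) := by
  have hx : 0 < T / L ^ 2 := by positivity
  have h1 : Real.exp (-(T / L ^ 2)) ≤ L ^ 2 / T := by
    rw [Real.exp_neg, ← inv_div T (L ^ 2)]
    exact inv_anti₀ hx (by linarith [Real.add_one_le_exp (T / L ^ 2)])
  calc (L + 1) ^ 2 * Real.exp (-(T / L ^ 2)) ≤ (2 * L) ^ 2 * (L ^ 2 / T) := by gcongr; linarith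
    _ = _ := by ring

/-- The entropy of the labels and the estimates is dominated by the separation `X`. -/
lemma pow_mul_exp_le {L n T : ℕ} (hL : 1 ≤ L) (hT : 2 ≤ T) {X : ℝ}
    (h1 : 6 * (T * L : ℝ) ≤ X) (h2 : 8 * (n * L * Real.log T) ≤ X) :
    ((L : ℝ) + 1) ^ T * (((T : ℝ) + 1) ^ n) ^ (L + 1) * Real.exp (T * L * Real.log 2 / 2 - X) ≤
      Real.exp (-T) := by
  have hL' : (1 : ℝ) ≤ L := by exact_mod_cast hL
  have hT' : (2 : ℝ) ≤ T := by exact_mod_cast hT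
  have e1 : ((L : ℝ) + 1) ^ T = Real.exp (T * Real.log (L + 1)) := by
    rw [← Real.log_pow, Real.exp_log (by positivity)]
  have e2 : (((T : ℝ) + 1) ^ n) ^ (L + 1) = Real.exp ((n * (L + 1)) * Real.log (T + 1)) := by
    rw [← pow_mul, ← Nat.cast_succ L, ← Nat.cast_mul, ← Real.log_pow, Real.exp_log (by positivity)]
  rw [e1, e2, ← Real.exp_add, ← Real.exp_add]
  refine Real.exp_le_exp.2 ?_
  have h3 : Real.log (L + 1) ≤ L := by
    have := Real.log_le_sub_one_of_pos (show (0 : ℝ) < L + 1 by positivity)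
    linarith
  have h4 : Real.log (T + 1) ≤ 2 * Real.log T := by
    have := Real.log_le_log (show (0 : ℝ) < T + 1 by positivity)
      (show (T : ℝ) + 1 ≤ T ^ 2 by nlinarith)
    rwa [Real.log_pow] at this
  have h5 : Real.log 2 ≤ 1 := by linarith [Real.log_two_lt_d9]
  have h6 : (T : ℝ) * Real.log (L + 1) ≤ T * L := by gcongr
  have h7 : (T : ℝ) * L * Real.log 2 / 2 ≤ T * L := by
    have := mul_le_mul_of_nonneg_left h5 (show (0 : ℝ) ≤ T * L by positivity)
    have h0 : (0 : ℝ) ≤ T * L := by positivity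
    linarith
  have h8 : (n : ℝ) * (L + 1) * Real.log (T + 1) ≤ n * (2 * L) * (2 * Real.log T) := by
    have h0 : 0 ≤ Real.log (T + 1) := Real.log_nonneg (by linarith)
    gcongr
    linarith
  have h9 : (T : ℝ) ≤ T * L := le_mul_of_one_le_right (by positivity) hL'
  -- The terms `T log (L + 1)`, `T L log 2 / 2` and `T` total at most `3 T L ≤ X / 2`; the remaining
  -- one is at most `4 n L log T ≤ X / 2`.
  nlinarith


/-- A bound on the probability of many errors in a single hub model. -/
lemma measure_numErrors_le_of_rates {Ω : Type*} [MeasurableSpace Ω] {μ : Measure Ω} {L n T : ℕ}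
    {ρ : Fin (L + 1) → ℝ} {A s : Fin (L + 1) → Fin n → ℝ} {zs : Ω → Fin T → Fin (L + 1)}
    {G : Ω → Fin T → Fin n → Bool} (hmodel : IsHubModel μ ρ A zs G)
    {zhat : Ω → Fin T → Fin (L + 1)} (hzhat : ∀ ω, IsProfileMLE (G ω) (zhat ω))
    {H : (Fin T → Fin (L + 1)) → Prop} {C c₀ d v τ smin smax ε : ℝ}
    {V : Fin (L + 1) → Finset (Fin n)}
    (hLn : L < n) (hL : 1 ≤ L) (hT : 2 ≤ T) (hC : 0 ≤ C) (hc₀ : 0 ≤ c₀) (hd : 0 < d) (hv : 0 ≤ v)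
    (hτ : 0 ≤ τ) (hsmin : 0 < smin) (hsmax : 0 < smax) (hd1 : smax * d < 1)
    (hH : ∀ z, H z → ∀ i, (count z i : ℝ) ≤ T * C / L)
    (hs : ∀ i j, ¬ IsNode i j → A i j = s i j * d ∧ smin ≤ s i j ∧ s i j ≤ smax)
    (hV : ∀ k, k ≠ 0 → ∀ k', k' ≠ 0 → k ≠ k' → Disjoint (V k) (V k'))
    (hVL : ∀ i, i ≠ 0 → ∀ j ∈ V i, L ≤ (j : ℕ))
    (hVcard : ∀ i, i ≠ 0 → v * n / L ≤ (V i).card)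
    (hsep : ∀ i, i ≠ 0 → ∀ i', i' ≠ i → ∀ j ∈ V i, τ ≤ s i j - s i' j)
    (hhub : ∀ i (j : Fin n), (j : ℕ) < L → ¬ IsNode i j → A i j ≤ c₀ / L)
    (hLε : 4 * (2 * c₀ * C + 1) + 4 * C ≤ ε * L)
    (h1 : 6 * (T * L : ℝ) ≤ τ ^ 2 * ε / (128 * smax) * (d * v * n * T / L))
    (h2 : 8 * (n * L * Real.log T) ≤ τ ^ 2 * ε / (128 * smax) * (d * v * n * T / L)) :
    μ {ω | ε * T ≤ numErrors (zs ω) (zhat ω)} ≤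
      μ {ω | H (zs ω)}ᶜ + ENNReal.ofReal (4 * ((L : ℝ) ^ 4 / T) + Real.exp (-T)) := by
  have hp := hmodel.param
  have hL' : (1 : ℝ) ≤ L := by exact_mod_cast hL
  have hL0 : (0 : ℝ) < L := by linarith
  have hT' : (2 : ℝ) ≤ T := by exact_mod_cast hT
  have hT0 : (0 : ℝ) < T := by linarith
  have hnode : ∀ (i : Fin (L + 1)) (j : Fin n), L ≤ (j : ℕ) → ¬ IsNode i j := fun i j hj h => by
    have h : (i : ℕ) = (j : ℕ) + 1 := h
    have := i.isLt
    omega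
  refine measure_numErrors_le hmodel hzhat H _ _ (fun z hz => ?_) (by positivity)
  -- `M` exceeds `2 N c = 2 c₀ C T / L²` by `T / L²`, which becomes the Chernoff exponent, while `L
  -- * M` is still `O(T / L)`.
  refine (sum_badGroups_le (δ := τ / (2 * √smax) * √d) (w := v * n / L) (c := c₀ / L)
    (M := (2 * c₀ * C + 1) * T / L ^ 2) (N := T * C / L) hLn hp.nonneg hp.le_one
    (fun i j hj => ?_) (fun i j hj => ?_) z V (by positivity) (by positivity) hV hVL hVcard ?_
    (by positivity) hhub (by positivity) (by positivity) (hH z hz)).trans ?_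
  · obtain ⟨h, h', -⟩ := hs i j (hnode i j hj)
    rw [h]
    exact mul_pos (hsmin.trans_le h') hd
  · obtain ⟨h, -, h'⟩ := hs i j (hnode i j hj)
    rw [h]
    exact (mul_le_mul_of_nonneg_right h' hd.le).trans_lt hd1
  · intro k hk k' hk' j hj
    obtain ⟨e, -, hmax⟩ := hs k j (hnode _ _ (hVL k hk j hj))
    obtain ⟨e', hmin, -⟩ := hs k' j (hnode _ _ (hVL k hk j hj))
    rw [e, e', Real.sqrt_mul' _ hd.le, Real.sqrt_mul' _ hd.le, ← add_mul]
    exact mul_le_mul_of_nonneg_right (sqrt_add_le_sqrt (hsmin.le.trans hmin)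
      (by linarith [hsep k hk k' hk' j hj]) hmax hsmax hτ) (Real.sqrt_nonneg _)
  · refine add_le_add ?_ (le_trans ?_ (pow_mul_exp_le hL hT h1 h2))
    · refine le_trans (le_of_eq ?_) (card_sq_mul_exp_le hL' hT0)
      congr 2
      field_simp
      ring
    · refine mul_le_mul_of_nonneg_left (Real.exp_le_exp.2 (sub_le_sub_left ?_ _)) (by positivity)
      have hδ : (τ / (2 * √smax) * √d) ^ 2 = τ ^ 2 * d / (4 * smax) := by
        rw [mul_pow, div_pow, mul_pow, Real.sq_sqrt hd.le, Real.sq_sqrt hsmax.le]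
        ring
      -- For large `L`, at least half of the `εT` errors must come from impurity.
      have he : ε * T / 2 ≤ ε * T - 2 * (L * ((2 * c₀ * C + 1) * T / L ^ 2)) -
          2 * (T * C / L) := by
        have e1 : 2 * (L * ((2 * c₀ * C + 1) * T / L ^ 2)) + 2 * (T * C / L) =
            (4 * (2 * c₀ * C + 1) + 4 * C) * (T / (2 * L)) := by
          field_simp
          ring
        have e2 : (4 * (2 * c₀ * C + 1) + 4 * C) * (T / (2 * L)) ≤ ε * L * (T / (2 * L)) :=
          mul_le_mul_of_nonneg_right hLε (by positivity)
        have e3 : ε * L * (T / (2 * L)) = ε * T / 2 := by field_simp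
        linarith
      rw [hδ]
      refine le_trans (le_of_eq ?_) (mul_le_mul_of_nonneg_left he (by positivity))
      field_simp
      ring

end HubModel

/-! ### The limit along the sequence. -/

theorem theorem5
    -- sizes of the hub set and of the node set, number of groups, density `d`, quantity `v`
    (nL n T : ℕ → ℕ) (d v : ℕ → ℝ)
    (hLn : ∀ m, nL m < n m)
    (hnL : Tendsto nL atTop atTop) (hn : Tendsto n atTop atTop) (hT : Tendsto T atTop atTop)
    (hd : ∀ m, 0 < d m) (hv : ∀ m, 0 < v m)
    -- the model
    (Ω : ℕ → Type*) [∀ m, MeasurableSpace (Ω m)] (μ : ∀ m, Measure (Ω m))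
    [∀ m, IsProbabilityMeasure (μ m)]
    (ρ : ∀ m, Fin (nL m + 1) → ℝ) (A : ∀ m, Fin (nL m + 1) → Fin (n m) → ℝ)
    (zs : ∀ m, Ω m → Fin (T m) → Fin (nL m + 1))
    (G : ∀ m, Ω m → Fin (T m) → Fin (n m) → Bool)
    (hmodel : ∀ m, HubModel.IsHubModel (μ m) (ρ m) (A m) (zs m) (G m))
    -- H1*, with probability tending to one
    (cmin cmax : ℝ) (hcmin : 0 < cmin)
    (H1 : Tendsto (fun m => μ m {ω | ∀ i : Fin (nL m + 1),
        (T m : ℝ) * cmin / (nL m : ℝ) ≤ (HubModel.count (zs m ω) i : ℝ) ∧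
        (HubModel.count (zs m ω) i : ℝ) ≤ (T m : ℝ) * cmax / (nL m : ℝ)}) atTop (𝓝 1))
    -- H2*
    (s : ∀ m, Fin (nL m + 1) → Fin (n m) → ℝ) (smin smax : ℝ) (hsmin : 0 < smin)
    (H2 : ∀ m i j, ¬ HubModel.IsNode i j →
      A m i j = s m i j * d m ∧ smin ≤ s m i j ∧ s m i j ≤ smax)
    (H2d : Tendsto d atTop (𝓝 0))
    -- H3*
    (V : ∀ m, Fin (nL m + 1) → Finset (Fin (n m))) (τ : ℝ) (hτ : 0 < τ)
    (H3V : ∀ m i, i ≠ 0 → ∀ j ∈ V m i, nL m ≤ (j : ℕ))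
    (H3card : ∀ m i, i ≠ 0 → v m * (n m : ℝ) / (nL m : ℝ) ≤ ((V m i).card : ℝ))
    (H3sep : ∀ m i, i ≠ 0 → ∀ i', i' ≠ i → ∀ j ∈ V m i, τ ≤ s m i j - s m i' j)
    -- H4*
    (c₀ : ℝ) (hc₀ : 0 < c₀)
    (H4 : ∀ m i (j : Fin (n m)), (j : ℕ) < nL m → ¬ HubModel.IsNode i j →
      A m i j ≤ c₀ / (nL m : ℝ))
    -- rates
    (R1 : Tendsto (fun m => (nL m : ℝ) ^ 4 * Real.log (T m) / (d m * (T m : ℝ) * v m))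
      atTop (𝓝 0))
    (R2 : Tendsto (fun m => Real.log (d m) ^ 2 * (nL m : ℝ) ^ 6 * Real.log (nL m) /
      (d m * (n m : ℝ) * v m ^ 2)) atTop (𝓝 0))
    (R3 : Tendsto (fun m => Real.log (T m) ^ 2 * (nL m : ℝ) ^ 6 * Real.log (nL m) /
      (d m * (n m : ℝ) * v m ^ 2)) atTop (𝓝 0))
    -- maximum profile likelihood hub labels, ties broken arbitrarily
    (zhat : ∀ m, Ω m → Fin (T m) → Fin (nL m + 1))
    (hzhat : ∀ m ω, HubModel.IsProfileMLE (G m ω) (zhat m ω)) :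
    ∀ ε : ℝ, 0 < ε → Tendsto (fun m => μ m {ω |
      ε ≤ (HubModel.numErrors (zs m ω) (zhat m ω) : ℝ) / (T m : ℝ)}) atTop (𝓝 0) := by
  intro ε hε
  have hsmax : 0 < smax := by
    have hj : 0 < n 0 := (Nat.zero_le _).trans_lt (hLn 0)
    obtain ⟨-, h1, h2⟩ := H2 0 0 ⟨0, hj⟩ (by simp [HubModel.IsNode])
    linarith
  -- A common node would have each of its two means exceed the other.
  have hV : ∀ m k, k ≠ 0 → ∀ k', k' ≠ 0 → k ≠ k' → Disjoint (V m k) (V m k') := by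
    intro m k hk k' hk' hne
    refine Finset.disjoint_left.2 fun j hj hj' => ?_
    have h1 := H3sep m k hk k' hne.symm j hj
    have h2 := H3sep m k' hk' k hne j hj'
    linarith
  set C := max cmax 0 with hCdef
  set κ := τ ^ 2 * ε / (128 * smax) with hκdef
  have hκ : 0 < κ := by positivity
  have hTr : Tendsto (fun m => (T m : ℝ)) atTop atTop := tendsto_natCast_atTop_atTop.comp hT
  have hLr : Tendsto (fun m => (nL m : ℝ)) atTop atTop := tendsto_natCast_atTop_atTop.comp hnL
  have ev_d : ∀ᶠ m in atTop, smax * d m < 1 := by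
    have : Tendsto (fun m => smax * d m) atTop (𝓝 (smax * 0)) := H2d.const_mul smax
    rw [mul_zero] at this
    exact this.eventually_lt_const one_pos
  have ev_d' : ∀ᶠ m in atTop, d m ≤ Real.exp (-1) := H2d.eventually_le_const (Real.exp_pos _)
  have ev_T : ∀ᶠ m in atTop, Real.exp 1 ≤ T m := hTr.eventually_ge_atTop _
  have ev_L : ∀ᶠ m in atTop, Real.exp 1 ≤ nL m := hLr.eventually_ge_atTop _
  -- consequences of the parameter ranges
  have ev : ∀ᶠ m in atTop, 1 ≤ (nL m : ℝ) ∧ 2 ≤ (T m : ℝ) ∧ v m ≤ 1 ∧ d m ≤ 1 ∧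
      1 ≤ Real.log (d m) ^ 2 ∧ 1 ≤ Real.log (nL m) ∧ 1 ≤ Real.log (T m) ∧ 0 < (n m : ℝ) := by
    filter_upwards [ev_d', ev_T, ev_L] with m h1 h2 h3
    have he : (2 : ℝ) ≤ Real.exp 1 := by linarith [Real.add_one_le_exp (1 : ℝ)]
    have hL1 : 0 < nL m := by
      have : (0 : ℝ) < nL m := by linarith
      exact_mod_cast this
    have hn0 : 0 < n m := hL1.trans (hLn m)
    have hld : Real.log (d m) ≤ -1 := (Real.log_le_iff_le_exp (hd m)).2 h1
    refine ⟨by linarith, by linarith,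
      HubModel.le_one_of_disjoint hL1 hn0 (V m) (hV m) (H3card m),
      h1.trans (Real.exp_le_one_iff.2 (by norm_num)), by nlinarith,
      (Real.le_log_iff_exp_le (by linarith)).2 h3, (Real.le_log_iff_exp_le (by linarith)).2 h2,
      by exact_mod_cast hn0⟩
  have lim4 : Tendsto (fun m => (nL m : ℝ) ^ 4 / T m) atTop (𝓝 0) := by
    refine squeeze_zero' (Eventually.of_forall fun m => by positivity) ?_ R1
    filter_upwards [ev] with m ⟨_, h2, h3, h4, _, _, h7, _⟩
    have hd0 := hd m
    have hv0 := hv m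
    have hT0 : (0 : ℝ) < T m := by linarith
    have hdv : d m * T m * v m ≤ T m := by
      have : d m * v m ≤ 1 := mul_le_one₀ h4 hv0.le h3
      nlinarith
    exact div_le_div₀ (by positivity) (le_mul_of_one_le_right (by positivity) h7) (by positivity)
      hdv
  -- The label entropy needs `L²` small against `d n v`, which `R2` gives since its logarithms are
  -- eventually at least `1` and `v ≤ 1`.
  have ev1 : ∀ᶠ m in atTop,
      6 * (T m * nL m : ℝ) ≤ κ * (d m * v m * n m * T m / nL m) := by
    filter_upwards [ev, R2.eventually_le_const (show (0 : ℝ) < κ / 6 by positivity)]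
      with m ⟨h1, h2, h3, h4, h5, h6, _, h8⟩ hR
    have hd0 := hd m
    have hv0 := hv m
    have hT0 : (0 : ℝ) < T m := by linarith
    have hL0 : (0 : ℝ) < nL m := by linarith
    rw [div_le_iff₀ (by positivity)] at hR
    have e1 : (nL m : ℝ) ^ 2 ≤ Real.log (d m) ^ 2 * (nL m : ℝ) ^ 6 * Real.log (nL m) := by
      calc (nL m : ℝ) ^ 2 ≤ (nL m : ℝ) ^ 6 := pow_le_pow_right₀ h1 (by norm_num)
        _ ≤ Real.log (d m) ^ 2 * (nL m : ℝ) ^ 6 := le_mul_of_one_le_left (by positivity) h5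
        _ ≤ _ := le_mul_of_one_le_right (by positivity) h6
    have e2 : d m * n m * v m ^ 2 ≤ d m * n m * v m :=
      mul_le_mul_of_nonneg_left (by nlinarith) (by positivity)
    have e3 : 6 * (nL m : ℝ) ^ 2 ≤ κ * (d m * n m * v m) := by
      have := mul_le_mul_of_nonneg_left e2 (show 0 ≤ κ / 6 by positivity)
      linarith
    have e4 := mul_le_mul_of_nonneg_right e3 (show 0 ≤ (T m : ℝ) / nL m by positivity)
    calc 6 * (T m * nL m : ℝ) = 6 * (nL m : ℝ) ^ 2 * (T m / nL m) := by field_simp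
      _ ≤ _ := e4
      _ = _ := by ring
  -- The entropy of the estimates needs `L² log T` small against `d T v`, which `R1` gives.
  have ev2 : ∀ᶠ m in atTop,
      8 * (n m * nL m * Real.log (T m)) ≤ κ * (d m * v m * n m * T m / nL m) := by
    filter_upwards [ev, R1.eventually_le_const (show (0 : ℝ) < κ / 8 by positivity)]
      with m ⟨h1, h2, h3, h4, h5, h6, h7, h8⟩ hR
    have hd0 := hd m
    have hv0 := hv m
    have hT0 : (0 : ℝ) < T m := by linarith
    have hL0 : (0 : ℝ) < nL m := by linarith
    rw [div_le_iff₀ (by positivity)] at hR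
    have e1 : (nL m : ℝ) ^ 2 * Real.log (T m) ≤ (nL m : ℝ) ^ 4 * Real.log (T m) :=
      mul_le_mul_of_nonneg_right (pow_le_pow_right₀ h1 (by norm_num)) (by linarith)
    have e3 : 8 * ((nL m : ℝ) ^ 2 * Real.log (T m)) ≤ κ * (d m * T m * v m) := by linarith
    have e4 := mul_le_mul_of_nonneg_right e3 (show 0 ≤ (n m : ℝ) / nL m by positivity)
    calc 8 * (n m * nL m * Real.log (T m)) =
          8 * ((nL m : ℝ) ^ 2 * Real.log (T m)) * (n m / nL m) := by field_simp
      _ ≤ _ := e4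
      _ = _ := by ring
  let H : ∀ m, (Fin (T m) → Fin (nL m + 1)) → Prop := fun m z => ∀ i : Fin (nL m + 1),
    (T m : ℝ) * cmin / (nL m : ℝ) ≤ (HubModel.count z i : ℝ) ∧
      (HubModel.count z i : ℝ) ≤ (T m : ℝ) * cmax / (nL m : ℝ)
  have lim_compl : Tendsto (fun m => μ m {ω | H m (zs m ω)}ᶜ) atTop (𝓝 0) := by
    have h1 : ∀ m, μ m {ω | H m (zs m ω)}ᶜ = 1 - μ m {ω | H m (zs m ω)} := fun m =>
      prob_compl_eq_one_sub ((hmodel m).measurable_label (Set.toFinite {z | H m z}).measurableSet)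
    simp_rw [h1]
    have := ENNReal.Tendsto.sub (tendsto_const_nhds (x := (1 : ENNReal)) (f := atTop)) H1
      (Or.inl ENNReal.one_ne_top)
    rwa [tsub_self] at this
  have lim_real : Tendsto (fun m => ENNReal.ofReal (4 * ((nL m : ℝ) ^ 4 / T m) +
      Real.exp (-T m))) atTop (𝓝 0) := by
    have h1 := (lim4.const_mul 4).add (Real.tendsto_exp_neg_atTop_nhds_zero.comp hTr)
    rw [mul_zero, add_zero] at h1
    have h2 := ENNReal.tendsto_ofReal h1
    rwa [ENNReal.ofReal_zero] at h2
  have lim := lim_compl.add lim_real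
  rw [add_zero] at lim
  refine tendsto_of_tendsto_of_tendsto_of_le_of_le' tendsto_const_nhds lim
    (Eventually.of_forall fun _ => zero_le) ?_
  filter_upwards [ev, ev1, ev2, ev_d,
    hLr.eventually_ge_atTop ((4 * (2 * c₀ * C + 1) + 4 * C) / ε)]
    with m ⟨h1, h2, h3, h4, h5, h6, h7, h8⟩ hr1 hr2 hdm hLε
  have hT0 : (0 : ℝ) < T m := by linarith
  have hset : {ω | ε ≤ (HubModel.numErrors (zs m ω) (zhat m ω) : ℝ) / (T m : ℝ)} =
      {ω | ε * T m ≤ HubModel.numErrors (zs m ω) (zhat m ω)} := by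
    ext ω
    exact le_div_iff₀ hT0
  rw [hset]
  refine HubModel.measure_numErrors_le_of_rates (hmodel m) (hzhat m) (hLn m)
    (by exact_mod_cast h1) (by exact_mod_cast h2) (le_max_right cmax 0) hc₀.le (hd m) (hv m).le
    hτ.le hsmin hsmax hdm (fun z hz i => (hz i).2.trans ?_) (H2 m) (hV m) (H3V m) (H3card m)
    (H3sep m) (H4 m) ?_ hr1 hr2
  · gcongr
    exact le_max_left _ _
  · rw [div_le_iff₀ hε] at hLε
    linarith
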